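/- Let $q\ge 2$ be an integer, let $\gamma\in\mathbb Z/q\mathbb Z$ be a unit, and let $\varepsilon=(\varepsilon_d)_{d\mid q}$ be a probability vector indexed by the positive divisors of $q$. All logarithms are to the base $q$. For a channel $W$ with finite input alphabet $\mathcal X$, finite output alphabet and transition probabilities $W(y\mid x)$, let $$I(W)=\sum_{y}\sum_{x\in\mathcal X}\frac{1}{|\mathcal X|}W(y\mid x)\log\frac{W(y\mid x)}{\sum_{x'\in\mathcal X}\frac{1}{|\mathcal X|}W(y\mid x')}$$ be its symmetric capacity (terms with $W(y\mid x)=0$ count as $0$). The modular arithmetic erasure channel $V_\varepsilon=\mathrm{MAEC}_q(\varepsilon)$ has input alphabet $\mathbb Z/q\mathbb Z$, output alphabet the disjoint union of the $\mathbb Z/d\mathbb Z$ for $d\mid q$, and $V_\varepsilon(y\mid x)=\varepsilon_d$ if $y=x+d\mathbb Z$ for some $d\mid q$, and $0$ otherwise. For a channel $W$ with input alphabet $\mathbb Z/q\mathbb Z$ put $$W^-(y_1,y_2\mid u_1)=\sum_{u_2}\tfrac1q W(y_1\mid u_1+\gamma u_2)W(y_2\mid u_2),\qquad W^+(y_1,y_2,u_1\mid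 u_2)=\tfrac1q W(y_1\mid u_1+\gamma u_2)W(y_2\mid u_2),$$ and $W^{s}=(\cdots(W^{s_1})^{s_2}\cdots)^{s_n}$ for $s=s_1\cdots s_n\in\{-,+\}^n$. For a subgroup $N\le\mathbb Z/q\mathbb Z$ the homomorphism channel $W[N]$ has input alphabet $(\mathbb Z/q\mathbb Z)/N$ and $W[N](y\mid a+N)=\frac1{|N|}\sum_{x\in a+N}W(y\mid x)$. For $d\mid q$ let $\varphi_d:\mathbb Z/q\mathbb Z\to\mathbb Z/d\mathbb Z$ be the natural projection. Define $\varepsilon^{s}$ recursively: $\varepsilon^{s}=\varepsilon$ for the empty sequence, and, for every finite sign sequence $s$, $$\varepsilon^{s-}_d=\sum_{\gcd(d_1,d_2)=d}\varepsilon^{s}_{d_1}\varepsilon^{s}_{d_2},\qquad \varepsilon^{s+}_d=\sum_{\mathrm{lcm}(d_1,d_2)=d}\varepsilon^{s}_{d_1}\varepsilon^{s}_{d_2},$$ the sums being over divisors $d_1,d_2$ of $q$. Let $\mu^{(n)}_d=2^{-n}\sum_{s\in\{-,+\}^n}\varepsilon^{s}_d$. Then the limit $\mu_d^{(\infty)}=\lim_{n\to\infty}\mu_d^{(n)}$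 exists for every $d\mid q$, the vector $(\mu_d^{(\infty)})_{d\mid q}$ is a probability vector, and, for every $\delta$ with $0<\delta<\log p$, where $p$ is the smallest prime factor of $q$, and for every $d\mid q$, $$\lim_{n\to\infty}\frac1{2^n}\Big|\Big\{s\in\{-,+\}^n : \big|I(V_\varepsilon^{s})-\log d\big|<\delta\ \text{and}\ \big|I(V_\varepsilon^{s}[\ker\varphi_d])-\log d\big|<\delta\Big\}\Big|=\mu_d^{(\infty)} .$$ -/

import Mathlib

open Filter Topology

noncomputable section

namespace MAEC

/-- The two symbols `-` and `+` indexing the polar transforms. -/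
inductive Sign : Type
  | minus : Sign
  | plus : Sign

/-- There are exactly two signs. -/
def signEquivBool : Sign ≃ Bool where
  toFun s := match s with
    | Sign.minus => false
    | Sign.plus => true
  invFun b := match b with
    | false => Sign.minus
    | true => Sign.plus
  left_inv s := by cases s <;> rfl
  right_inv b := by cases b <;> rfl

instance : Fintype Sign := Fintype.ofEquiv Bool signEquivBool.symm

/-- A discrete memoryless channel with input alphabet `X` and a finite output alphabet `Out`.
`W.prob x y` is the transition probability `W(y | x)`. -/
structure Channel (X : Type) where
  /-- the output alphabet -/
  Out : Type
  /-- the output alphabet is finite -/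
  fintypeOut : Fintype Out
  /-- the transition probabilities -/
  prob : X → Out → ℝ
  prob_nonneg : ∀ x y, 0 ≤ prob x y
  sum_prob : ∀ x, ∑ y, prob x y = 1

attribute [instance] Channel.fintypeOut

/-- The symmetric capacity `I(W)` (mutual information between input and output of `W` under
the uniform input distribution), with logarithms to the base `b`. Terms with `W(y | x) = 0`
contribute `0`. -/
def symmetricCapacity (b : ℝ) {X : Type} [Fintype X] (W : Channel X) : ℝ :=
  ∑ y, ∑ x, (1 / (Fintype.card X : ℝ)) * W.prob x y *
    Real.logb b (W.prob x y / ∑ x', (1 / (Fintype.card X : ℝ)) * W.prob x' y)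

section PolarTransform

variable {q : ℕ} [NeZero q]

/-- The worse channel `W₁ ⊟_γ W₂ : ℤ/qℤ → 𝒴₁ × 𝒴₂`. -/
def worse (γ : ZMod q) (W₁ W₂ : Channel (ZMod q)) : Channel (ZMod q) where
  Out := W₁.Out × W₂.Out
  fintypeOut := inferInstance
  prob u₁ y := ∑ u₂ : ZMod q, (1 / (q : ℝ)) * W₁.prob (u₁ + γ * u₂) y.1 * W₂.prob u₂ y.2
  prob_nonneg u₁ y := Finset.sum_nonneg fun u₂ _ =>
    mul_nonneg (mul_nonneg (by positivity) (W₁.prob_nonneg _ _)) (W₂.prob_nonneg _ _)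
  sum_prob u₁ := by
    have hq : (q : ℝ) ≠ 0 := Nat.cast_ne_zero.mpr (NeZero.ne q)
    rw [Finset.sum_comm]
    simp_rw [Fintype.sum_prod_type, ← Finset.mul_sum, W₂.sum_prob, mul_one,
      ← Finset.mul_sum, W₁.sum_prob]
    simp [ZMod.card, hq]

/-- The better channel `W₁ ⊞_γ W₂ : ℤ/qℤ → 𝒴₁ × 𝒴₂ × ℤ/qℤ`. -/
def better (γ : ZMod q) (W₁ W₂ : Channel (ZMod q)) : Channel (ZMod q) where
  Out := W₁.Out × W₂.Out × ZMod q
  fintypeOut := inferInstance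
  prob u₂ y := (1 / (q : ℝ)) * W₁.prob (y.2.2 + γ * u₂) y.1 * W₂.prob u₂ y.2.1
  prob_nonneg u₂ y :=
    mul_nonneg (mul_nonneg (by positivity) (W₁.prob_nonneg _ _)) (W₂.prob_nonneg _ _)
  sum_prob u₂ := by
    have hq : (q : ℝ) ≠ 0 := Nat.cast_ne_zero.mpr (NeZero.ne q)
    simp_rw [Fintype.sum_prod_type]
    have h1 : ∀ y₁ : W₁.Out, (∑ y₂ : W₂.Out, ∑ u₁ : ZMod q,
        (1 / (q : ℝ)) * W₁.prob (u₁ + γ * u₂) y₁ * W₂.prob u₂ y₂) =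
        ∑ u₁ : ZMod q, (1 / (q : ℝ)) * W₁.prob (u₁ + γ * u₂) y₁ := fun y₁ => by
      rw [Finset.sum_comm]
      exact Finset.sum_congr rfl fun u₁ _ => by rw [← Finset.mul_sum, W₂.sum_prob, mul_one]
    simp_rw [h1]
    rw [Finset.sum_comm]
    simp_rw [← Finset.mul_sum, W₁.sum_prob]
    simp [ZMod.card, hq]

/-- One step of the polar transform: `W⁻ = W ⊟_γ W` and `W⁺ = W ⊞_γ W`. -/
def polarStep (γ : ZMod q) (W : Channel (ZMod q)) : Sign → Channel (ZMod q)
  | Sign.minus => worse γ W W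
  | Sign.plus => better γ W W

/-- The synthetic channel `W^s = (⋯(W^{s₁})^{s₂}⋯)^{sₙ}`. -/
def synthetic (γ : ZMod q) (W : Channel (ZMod q)) (s : List Sign) : Channel (ZMod q) :=
  s.foldl (polarStep γ) W

end PolarTransform

section Homomorphism

variable {G : Type} [AddCommGroup G] [Fintype G]

open Classical in
/-- The homomorphism channel `W[N] : G ⧸ N → 𝒴`,
`W[N](y | a + N) = |N|⁻¹ ∑_{x ∈ a + N} W(y | x)`. -/
def homChannel (W : Channel G) (N : AddSubgroup G) : Channel (G ⧸ N) where
  Out := W.Out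
  fintypeOut := inferInstance
  prob a y := (1 / (Nat.card N : ℝ)) *
    ∑ x ∈ Finset.univ.filter (fun x : G => (QuotientAddGroup.mk x : G ⧸ N) = a), W.prob x y
  prob_nonneg a y := mul_nonneg (by positivity)
    (Finset.sum_nonneg fun x _ => W.prob_nonneg x y)
  sum_prob a := by
    rw [← Finset.mul_sum, Finset.sum_comm]
    simp_rw [W.sum_prob]
    have h2 : (Finset.univ.filter (fun x : G => (QuotientAddGroup.mk x : G ⧸ N) = a)).card =
        Nat.card N := by
      rw [← Fintype.card_subtype, ← Nat.card_eq_fintype_card]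
      obtain ⟨a, rfl⟩ := QuotientAddGroup.mk_surjective a
      refine Nat.card_congr ⟨fun x => ⟨-a + x.1, QuotientAddGroup.eq.mp x.2.symm⟩,
        fun n => ⟨a + n.1, (QuotientAddGroup.eq.mpr (by simp)).symm⟩, ?_, ?_⟩
      · intro x; simp
      · intro n; simp
    rw [Finset.sum_const, h2]
    simp

end Homomorphism

open Classical in
/-- The symmetric capacity `I(W[N])` of a homomorphism channel, logarithms to the base `b`. -/
def homCapacity (b : ℝ) {G : Type} [AddCommGroup G] [Fintype G]
    (W : Channel G) (N : AddSubgroup G) : ℝ :=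
  symmetricCapacity b (homChannel W N)

section Erasure

variable {q : ℕ}

/-- The natural projection `φ_d : ℤ/qℤ → ℤ/dℤ` for a divisor `d` of `q`. -/
def proj (d : q.divisors) : ZMod q →+ ZMod (d : ℕ) :=
  (ZMod.castHom (Nat.dvd_of_mem_divisors d.2) (ZMod (d : ℕ))).toAddMonoidHom

instance (d : q.divisors) : NeZero (d : ℕ) := ⟨(Nat.pos_of_mem_divisors d.2).ne'⟩

/-- The modular arithmetic erasure channel `MAEC_q(ε)` with input alphabet `ℤ/qℤ`. The output
alphabet is the disjoint union of the `ℤ/dℤ` over the divisors `d` of `q`; the input `x` is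
received as `x mod d` with probability `ε_d`. -/
def maec (ε : q.divisors → ℝ) (hε : ε ∈ stdSimplex ℝ q.divisors) : Channel (ZMod q) where
  Out := Σ d : q.divisors, ZMod (d : ℕ)
  fintypeOut := inferInstance
  prob x y := if y.2 = proj y.1 x then ε y.1 else 0
  prob_nonneg x y := by
    split_ifs
    · exact hε.1 _
    · exact le_rfl
  sum_prob x := by
    rw [Fintype.sum_sigma]
    refine Eq.trans (Finset.sum_congr rfl fun d _ => ?_) hε.2
    refine (Finset.sum_eq_single (proj d x) (fun z _ hz => if_neg hz) ?_).trans (if_pos rfl)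
    exact fun h => absurd (Finset.mem_univ _) h

/-- The transforms of underlying probability vectors:
`ε⁻_d = ∑_{gcd(d₁,d₂)=d} ε_{d₁} ε_{d₂}` and `ε⁺_d = ∑_{lcm(d₁,d₂)=d} ε_{d₁} ε_{d₂}`. -/
def epsStep (ε : q.divisors → ℝ) : Sign → q.divisors → ℝ
  | Sign.minus => fun d => ∑ d₁ : q.divisors, ∑ d₂ : q.divisors,
      if Nat.gcd d₁ d₂ = d then ε d₁ * ε d₂ else 0
  | Sign.plus => fun d => ∑ d₁ : q.divisors, ∑ d₂ : q.divisors,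
      if Nat.lcm d₁ d₂ = d then ε d₁ * ε d₂ else 0

/-- The vector `ε^s`, defined recursively from `ε` along the sign sequence `s`. -/
def epsSeq (ε : q.divisors → ℝ) (s : List Sign) : q.divisors → ℝ :=
  s.foldl epsStep ε

/-- `μ_d^{(n)}`: the average of `ε_d^s` over all sign sequences `s` of length `n`. -/
def mu (ε : q.divisors → ℝ) (n : ℕ) (d : q.divisors) : ℝ :=
  (1 / (2 : ℝ) ^ n) * ∑ s : Fin n → Sign, epsSeq ε (List.ofFn s) d

/-- The proportion, among the sign sequences `s` of length `n`, of those for which both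
`I(V_ε^s)` and `I(V_ε^s[ker φ_d])` are at distance less than `δ` from `log d`; all logarithms
are to the base `q`. -/
def levelFraction [NeZero q] (γ : ZMod q) (ε : q.divisors → ℝ)
    (hε : ε ∈ stdSimplex ℝ q.divisors) (δ : ℝ) (d : q.divisors) (n : ℕ) : ℝ :=
  (1 / (2 : ℝ) ^ n) * (Set.ncard {s : Fin n → Sign |
    |symmetricCapacity q (synthetic γ (maec ε hε) (List.ofFn s)) - Real.logb q (d : ℕ)| < δ ∧
    |homCapacity q (synthetic γ (maec ε hε) (List.ofFn s)) (proj d).ker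
      - Real.logb q (d : ℕ)| < δ} : ℝ)

end Erasure

end MAEC

end

/-!
Every output of `V_ε^s` reveals exactly the residue of the input modulo some divisor of `q`, and
the divisor is `d` with probability `ε^s_d` (`HasErasureProfile`, `synthetic_profile`). Indeed,
knowing `u₁ + γ u₂` modulo `d` and `u₂` modulo `e` amounts to knowing `u₁` modulo `gcd(d, e)` when
`u₂` is uniform and unobserved, and `u₂` modulo `lcm(d, e)` once `u₁` is known. Hence
`I(V_ε^s) = ∑ ε^s_e log e` and `I(V_ε^s[ker φ_d]) = ∑ ε^s_e log gcd(d, e)`, and the rest of the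
argument concerns the vectors `ε^s` alone.

For `t ∣ q` let `g` be the mass that `ε` gives to the multiples of `t` (`upperMass`). Under `-` it
becomes `g²`, and under `+` it becomes at least `2g - g²`. Thus the average of `g` over all sign
sequences of length `n` is nondecreasing in `n`, so it converges, and so do the averages
`μ_d^{(n)}`, which are fixed linear combinations of such averages (`exists_tendsto_mu`). The
average of `g²` grows by at least the average of `(g (1 - g))²` at each step; being bounded by `1`,
it forces the latter to tend to `0` (`tendsto_signAvg_sq`). So for most `s` all the masses `g`
are near `0` or `1`, and then `ε^s` is nearly a point mass at some divisor `d₀` (`exists_concentrated`).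

For such an `s` the two capacities are near `log d₀` and `log gcd(d, d₀)`. As `δ < log p`, both are
within `δ` of `log d` exactly when `d = d₀`: otherwise `d / gcd(d, d₀)` or `d₀ / d` would be a
divisor of `q` strictly between `1` and `p` (`nearLevel_iff`). The indicator of the event counted
is therefore close to `ε^s_d` for most `s`, and averaging gives `μ_d^{(∞)}`.
-/

namespace MAEC

variable {q : ℕ}

/-! ### Residues modulo the divisors of `q` -/

theorem proj_surjective (d : q.divisors) : Function.Surjective (proj d) :=
  ZMod.castHom_surjective (Nat.dvd_of_mem_divisors d.2)

theorem proj_natCast (d : q.divisors) (n : ℕ) : proj d (n : ZMod q) = n :=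
  map_natCast (ZMod.castHom (Nat.dvd_of_mem_divisors d.2) (ZMod (d : ℕ))) n

theorem proj_mul (d : q.divisors) (x y : ZMod q) : proj d (x * y) = proj d x * proj d y :=
  map_mul (ZMod.castHom (Nat.dvd_of_mem_divisors d.2) (ZMod (d : ℕ))) x y

theorem proj_natCast_eq_iff (d : q.divisors) (m n : ℕ) :
    proj d (m : ZMod q) = proj d (n : ZMod q) ↔ m ≡ n [MOD d] := by
  rw [proj_natCast, proj_natCast, ZMod.natCast_eq_natCast_iff]

theorem divisors_pos (d : q.divisors) : 0 < (d : ℕ) := Nat.pos_of_mem_divisors d.2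

section

variable [NeZero q]

/-- The greatest common divisor, as an operation on the divisors of `q`. -/
def gcdDiv (d e : q.divisors) : q.divisors :=
  ⟨Nat.gcd d e, Nat.mem_divisors.2
    ⟨(Nat.gcd_dvd_left _ _).trans (Nat.dvd_of_mem_divisors d.2), NeZero.ne q⟩⟩

/-- The least common multiple, as an operation on the divisors of `q`. -/
def lcmDiv (d e : q.divisors) : q.divisors :=
  ⟨Nat.lcm d e, Nat.mem_divisors.2
    ⟨Nat.lcm_dvd (Nat.dvd_of_mem_divisors d.2) (Nat.dvd_of_mem_divisors e.2), NeZero.ne q⟩⟩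

theorem coe_gcdDiv (d e : q.divisors) : (gcdDiv d e : ℕ) = Nat.gcd d e := rfl

theorem coe_lcmDiv (d e : q.divisors) : (lcmDiv d e : ℕ) = Nat.lcm d e := rfl

theorem gcd_mul_lcm_cast (d e : q.divisors) :
    ((gcdDiv d e : ℕ) : ℝ) * ((lcmDiv d e : ℕ) : ℝ) = (d : ℕ) * (e : ℕ) := by
  exact_mod_cast Nat.gcd_mul_lcm d e

/-- The fibres of `φ_d` all have `q / d` elements. -/
theorem card_filter_proj (d : q.divisors) (z : ZMod (d : ℕ)) :
    ((Finset.univ.filter fun x : ZMod q => proj d x = z).card : ℝ) = q / (d : ℕ) := by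
  have h1 : ∀ z', (Finset.univ.filter fun x : ZMod q => proj d x = z').card =
      (Finset.univ.filter fun x : ZMod q => proj d x = z).card := fun z' =>
    AddMonoidHom.card_fiber_eq_of_mem_range (proj d) (proj_surjective d z') (proj_surjective d z)
  have h2 := Finset.card_eq_sum_card_fiberwise (s := (Finset.univ : Finset (ZMod q)))
    (t := (Finset.univ : Finset (ZMod (d : ℕ)))) (f := proj d) (fun _ _ => by simp)
  rw [Finset.sum_congr rfl fun z' _ => h1 z'] at h2
  simp only [Finset.card_univ, ZMod.card, Finset.sum_const, smul_eq_mul] at h2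
  have := divisors_pos d
  rw [eq_div_iff (by positivity), mul_comm]
  exact_mod_cast h2.symm

/-- Agreement modulo `d` and modulo `e` is agreement modulo `lcm(d, e)`. -/
theorem proj_lcm_eq_iff (d e : q.divisors) (x y : ZMod q) :
    proj (lcmDiv d e) x = proj (lcmDiv d e) y ↔ proj d x = proj d y ∧ proj e x = proj e y := by
  rw [← ZMod.natCast_zmod_val x, ← ZMod.natCast_zmod_val y]
  simp only [proj_natCast_eq_iff]
  rw [coe_lcmDiv]
  constructor
  · exact fun h => ⟨h.of_dvd (Nat.dvd_lcm_left _ _), h.of_dvd (Nat.dvd_lcm_right _ _)⟩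
  · rintro ⟨h1, h2⟩
    rw [Nat.modEq_iff_dvd] at *
    have := Int.natCast_dvd.1 h1
    have := Int.natCast_dvd.1 h2
    exact Int.natCast_dvd.2 (Nat.lcm_dvd ‹_› ‹_›)

theorem proj_eq_of_dvd {d e : q.divisors} (h : (d : ℕ) ∣ e) {x y : ZMod q}
    (hxy : proj e x = proj e y) : proj d x = proj d y := by
  rw [← ZMod.natCast_zmod_val x, ← ZMod.natCast_zmod_val y] at *
  rw [proj_natCast_eq_iff] at *
  exact hxy.of_dvd h

/-- The Chinese remainder theorem for moduli that need not be coprime. -/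
theorem exists_proj_eq_iff (d e : q.divisors) (x y : ZMod q) :
    (∃ u, proj d u = proj d x ∧ proj e u = proj e y) ↔
      proj (gcdDiv d e) x = proj (gcdDiv d e) y := by
  constructor
  · rintro ⟨u, h1, h2⟩
    exact (proj_eq_of_dvd (Nat.gcd_dvd_left _ _) h1).symm.trans
      (proj_eq_of_dvd (Nat.gcd_dvd_right _ _) h2)
  · intro h
    rw [← ZMod.natCast_zmod_val x, ← ZMod.natCast_zmod_val y] at *
    rw [proj_natCast_eq_iff] at h
    obtain ⟨k, hk1, hk2⟩ := Nat.chineseRemainder' h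
    exact ⟨k, (proj_natCast_eq_iff _ _ _).2 hk1, (proj_natCast_eq_iff _ _ _).2 hk2⟩

/-- The number of common elements of two residue classes. -/
theorem card_filter_proj_and (d e : q.divisors) (x y : ZMod q) :
    ((Finset.univ.filter fun u : ZMod q => proj d u = proj d x ∧ proj e u = proj e y).card : ℝ) =
      if proj (gcdDiv d e) x = proj (gcdDiv d e) y then (q : ℝ) / (lcmDiv d e : ℕ) else 0 := by
  split_ifs with h
  · obtain ⟨u, h1, h2⟩ := (exists_proj_eq_iff d e x y).2 h
    rw [← h1, ← h2]
    simp_rw [← proj_lcm_eq_iff]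
    exact card_filter_proj _ _
  · rw [Nat.cast_eq_zero, Finset.card_eq_zero, Finset.filter_eq_empty_iff]
    exact fun u _ hu => h ((exists_proj_eq_iff d e x y).1 ⟨u, hu⟩)

end

/-! ### Erasure profiles of the synthetic channels -/

/-- `W` has erasure profile `ε` if every output `y` reveals exactly the residue of the input
modulo some divisor `D y` of `q`: the function `x ↦ W(y | x)` is a constant `c y` on the class of
`a y` modulo `D y` and vanishes elsewhere. A class modulo `d` has `q / d` elements, so the outputs
with `D y = d` have total probability `ε d` under a uniform input when their values `c y` sum to
`d * ε d`. -/
def HasErasureProfile (W : Channel (ZMod q)) (ε : q.divisors → ℝ) : Prop :=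
  ∃ (D : W.Out → q.divisors) (a : W.Out → ZMod q) (c : W.Out → ℝ),
    (∀ x y, W.prob x y = if proj (D y) x = proj (D y) (a y) then c y else 0) ∧
    ∀ d, (∑ y, if D y = d then c y else 0) = (d : ℕ) * ε d

theorem sum_mul_of_profile {Y : Type} [Fintype Y] {D : Y → q.divisors} {c : Y → ℝ}
    {ε : q.divisors → ℝ} (h : ∀ d, (∑ y, if D y = d then c y else 0) = (d : ℕ) * ε d)
    (g : q.divisors → ℝ) : ∑ y, c y * g (D y) = ∑ d : q.divisors, (d : ℕ) * ε d * g d := by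
  simp_rw [← h, Finset.sum_mul]
  rw [Finset.sum_comm]
  refine Finset.sum_congr rfl fun y _ => ?_
  simp [ite_mul]

theorem sum_sum_mul_of_profile {Y : Type} [Fintype Y] {D : Y → q.divisors} {c : Y → ℝ}
    {ε : q.divisors → ℝ} (h : ∀ d, (∑ y, if D y = d then c y else 0) = (d : ℕ) * ε d)
    (g : q.divisors → q.divisors → ℝ) :
    ∑ y₁, ∑ y₂, c y₁ * c y₂ * g (D y₁) (D y₂) =
      ∑ d : q.divisors, ∑ e : q.divisors, (d : ℕ) * ε d * ((e : ℕ) * ε e) * g d e := by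
  have h1 : ∀ d, ∑ y₂, c y₂ * g d (D y₂) = ∑ e : q.divisors, (e : ℕ) * ε e * g d e :=
    fun d => sum_mul_of_profile h (g d)
  simp_rw [mul_assoc, ← Finset.mul_sum, h1]
  rw [sum_mul_of_profile h fun d => ∑ e : q.divisors, (e : ℕ) * ε e * g d e]
  simp_rw [Finset.mul_sum, mul_assoc]

theorem maec_profile (ε : q.divisors → ℝ) (hε : ε ∈ stdSimplex ℝ q.divisors) :
    HasErasureProfile (maec ε hε) ε := by
  choose r hr using fun y : Σ d : q.divisors, ZMod (d : ℕ) => proj_surjective y.1 y.2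
  refine ⟨fun y => y.1, r, fun y => ε y.1, fun x y => ?_, fun d => ?_⟩
  · change (if y.2 = proj y.1 x then ε y.1 else 0) =
      if proj y.1 x = proj y.1 (r y) then ε y.1 else 0
    rw [hr y]
    simp only [eq_comm]
  · change (∑ y : Σ d : q.divisors, ZMod (d : ℕ), if y.1 = d then ε y.1 else 0) = _
    rw [Fintype.sum_sigma]
    simp [ZMod.card]

section

variable [NeZero q]

/-- Under `⊟`, an output pair revealing residues modulo `d` and `e` reveals the residue of `u₁`
modulo `gcd(d, e)`. -/
theorem worse_profile {γ : ZMod q} (hγ : IsUnit γ) {W : Channel (ZMod q)} {ε : q.divisors → ℝ}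
    (h : HasErasureProfile W ε) : HasErasureProfile (worse γ W W) (epsStep ε Sign.minus) := by
  obtain ⟨D, a, c, hp, hs⟩ := h
  obtain ⟨γ, rfl⟩ := hγ
  refine ⟨fun y => gcdDiv (D y.1) (D y.2), fun y => a y.1 - γ * a y.2,
    fun y => c y.1 * c y.2 * (1 / (lcmDiv (D y.1) (D y.2) : ℕ)), fun u y => ?_, fun d => ?_⟩
  · change ∑ u₂ : ZMod q, (1 / (q : ℝ)) * W.prob (u + γ * u₂) y.1 * W.prob u₂ y.2 = _
    have h1 : ∀ u₂ : ZMod q, (1 / (q : ℝ)) * W.prob (u + γ * u₂) y.1 * W.prob u₂ y.2 =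
        if proj (D y.1) u₂ = proj (D y.1) (↑γ⁻¹ * (a y.1 - u)) ∧
          proj (D y.2) u₂ = proj (D y.2) (a y.2) then (1 / (q : ℝ)) * c y.1 * c y.2 else 0 := by
      intro u₂
      have h2 : proj (D y.1) (u + γ * u₂) = proj (D y.1) (a y.1) ↔
          proj (D y.1) u₂ = proj (D y.1) (↑γ⁻¹ * (a y.1 - u)) := by
        rw [proj_mul, map_add, proj_mul, map_sub, ← eq_sub_iff_add_eq']
        have h3 : proj (D y.1) (γ : ZMod q) * proj (D y.1) (↑γ⁻¹ : ZMod q) = 1 := by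
          rw [← proj_mul, Units.mul_inv]
          simpa using proj_natCast (D y.1) 1
        constructor
        · intro h; rw [← h]; linear_combination (-proj (D y.1) u₂) * h3
        · intro h; rw [h]; linear_combination (proj (D y.1) (a y.1) - proj (D y.1) u) * h3
      rw [hp, hp, if_congr h2 rfl rfl]
      by_cases k1 : proj (D y.1) u₂ = proj (D y.1) (↑γ⁻¹ * (a y.1 - u)) <;>
        by_cases k2 : proj (D y.2) u₂ = proj (D y.2) (a y.2) <;> simp [k1, k2]
    -- The summands are constant on the solutions `u₂` of two congruences, `q / lcm` in number.
    rw [Finset.sum_congr rfl fun u₂ _ => h1 u₂, ← Finset.sum_filter, Finset.sum_const,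
      nsmul_eq_mul, card_filter_proj_and]
    have h4 : proj (gcdDiv (D y.1) (D y.2)) (↑γ⁻¹ * (a y.1 - u)) =
        proj (gcdDiv (D y.1) (D y.2)) (a y.2) ↔ proj (gcdDiv (D y.1) (D y.2)) u =
        proj (gcdDiv (D y.1) (D y.2)) (a y.1 - γ * a y.2) := by
      set g := gcdDiv (D y.1) (D y.2)
      have h3 : proj g (γ : ZMod q) * proj g (↑γ⁻¹ : ZMod q) = 1 := by
        rw [← proj_mul, Units.mul_inv]
        simpa using proj_natCast g 1
      simp only [proj_mul, map_sub]
      constructor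
      · intro h; rw [← h]; linear_combination (proj g (a y.1) - proj g u) * h3
      · intro h; rw [h]; linear_combination (proj g (a y.2)) * h3
    rw [if_congr h4 rfl rfl]
    have hq : (q : ℝ) ≠ 0 := Nat.cast_ne_zero.mpr (NeZero.ne q)
    split_ifs
    · field_simp
    · simp
  · change (∑ y : W.Out × W.Out, _) = _
    rw [Fintype.sum_prod_type]
    have := sum_sum_mul_of_profile hs fun e f =>
      if gcdDiv e f = d then (1 / (lcmDiv e f : ℕ) : ℝ) else 0
    simp only [mul_ite, mul_zero] at this
    rw [this]
    simp only [epsStep, Finset.mul_sum]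
    refine Finset.sum_congr rfl fun e _ => Finset.sum_congr rfl fun f _ => ?_
    simp only [Subtype.ext_iff, coe_gcdDiv]
    split_ifs with hd
    · have h5 := gcd_mul_lcm_cast e f
      have h6 : ((lcmDiv e f : ℕ) : ℝ) ≠ 0 := by exact_mod_cast (divisors_pos _).ne'
      rw [coe_gcdDiv, hd] at h5
      field_simp
      linear_combination (-ε e * ε f) * h5
    · simp

open Classical in
/-- Under `⊞`, an output pair revealing residues modulo `d` and `e` reveals the residue of `u₂`
modulo `lcm(d, e)`. -/
theorem better_profile {γ : ZMod q} (hγ : IsUnit γ) {W : Channel (ZMod q)} {ε : q.divisors → ℝ}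
    (h : HasErasureProfile W ε) : HasErasureProfile (better γ W W) (epsStep ε Sign.plus) := by
  obtain ⟨D, a, c, hp, hs⟩ := h
  obtain ⟨γ, rfl⟩ := hγ
  have hq : (q : ℝ) ≠ 0 := Nat.cast_ne_zero.mpr (NeZero.ne q)
  have hinv : ∀ d : q.divisors, proj d (γ : ZMod q) * proj d (↑γ⁻¹ : ZMod q) = 1 := fun d => by
    rw [← proj_mul, Units.mul_inv]
    simpa using proj_natCast d 1
  -- `y = (y₁, y₂, u₁)` is possible only if `u₁` agrees with `a y₁ - γ a y₂` modulo the gcd. An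
  -- impossible output keeps its divisor, with an arbitrary residue and the constant `0`.
  have hex : ∀ y : W.Out × W.Out × ZMod q, ∃ b : ZMod q,
      proj (gcdDiv (D y.1) (D y.2.1)) y.2.2 =
        proj (gcdDiv (D y.1) (D y.2.1)) (a y.1 - γ * a y.2.1) →
      proj (D y.1) b = proj (D y.1) (↑γ⁻¹ * (a y.1 - y.2.2)) ∧
      proj (D y.2.1) b = proj (D y.2.1) (a y.2.1) := by
    intro y
    by_cases hy : proj (gcdDiv (D y.1) (D y.2.1)) y.2.2 =
        proj (gcdDiv (D y.1) (D y.2.1)) (a y.1 - γ * a y.2.1)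
    · obtain ⟨b, hb⟩ := (exists_proj_eq_iff (D y.1) (D y.2.1) (↑γ⁻¹ * (a y.1 - y.2.2))
        (a y.2.1)).2 (by
          simp only [proj_mul, map_sub, hy]
          linear_combination (proj _ (a y.2.1)) * hinv (gcdDiv (D y.1) (D y.2.1)))
      exact ⟨b, fun _ => hb⟩
    · exact ⟨0, fun h => absurd h hy⟩
  choose b hb using hex
  refine ⟨fun y => lcmDiv (D y.1) (D y.2.1), b,
    fun y => if proj (gcdDiv (D y.1) (D y.2.1)) y.2.2 =
        proj (gcdDiv (D y.1) (D y.2.1)) (a y.1 - γ * a y.2.1) then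
      (1 / (q : ℝ)) * c y.1 * c y.2.1 else 0, fun u y => ?_, fun d => ?_⟩
  · change (1 / (q : ℝ)) * W.prob (y.2.2 + γ * u) y.1 * W.prob u y.2.1 = _
    have h2 : proj (D y.1) (y.2.2 + γ * u) = proj (D y.1) (a y.1) ↔
        proj (D y.1) u = proj (D y.1) (↑γ⁻¹ * (a y.1 - y.2.2)) := by
      rw [proj_mul, map_add, proj_mul, map_sub, ← eq_sub_iff_add_eq']
      constructor
      · intro h; rw [← h]; linear_combination (-proj (D y.1) u) * hinv (D y.1)
      · intro h; rw [h]
        linear_combination (proj (D y.1) (a y.1) - proj (D y.1) y.2.2) * hinv (D y.1)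
    rw [hp, hp, if_congr h2 rfl rfl]
    by_cases hy : proj (gcdDiv (D y.1) (D y.2.1)) y.2.2 =
        proj (gcdDiv (D y.1) (D y.2.1)) (a y.1 - γ * a y.2.1)
    · obtain ⟨h3, h4⟩ := hb y hy
      simp only [proj_lcm_eq_iff, h3, h4, hy, if_true]
      by_cases k1 : proj (D y.1) u = proj (D y.1) (↑γ⁻¹ * (a y.1 - y.2.2)) <;>
        by_cases k2 : proj (D y.2.1) u = proj (D y.2.1) (a y.2.1) <;> simp [k1, k2]
    · have : ¬ (proj (D y.1) u = proj (D y.1) (↑γ⁻¹ * (a y.1 - y.2.2)) ∧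
          proj (D y.2.1) u = proj (D y.2.1) (a y.2.1)) := by
        intro hu
        have h5 := (exists_proj_eq_iff _ _ _ _).1 ⟨u, hu⟩
        refine hy ?_
        simp only [proj_mul, map_sub] at h5 ⊢
        rw [← h5]
        linear_combination (proj _ (a y.1) - proj _ y.2.2) * hinv (gcdDiv (D y.1) (D y.2.1))
      simp only [hy, if_false, ite_self]
      by_cases k1 : proj (D y.1) u = proj (D y.1) (↑γ⁻¹ * (a y.1 - y.2.2)) <;>
        by_cases k2 : proj (D y.2.1) u = proj (D y.2.1) (a y.2.1) <;> simp_all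
  · change (∑ y : W.Out × W.Out × ZMod q, _) = _
    simp_rw [Fintype.sum_prod_type]
    -- Given `y₁` and `y₂`, there are `q / gcd` possible values of `u₁`.
    have h6 : ∀ y₁ y₂, (∑ u : ZMod q, if lcmDiv (D y₁) (D y₂) = d then
        (if proj (gcdDiv (D y₁) (D y₂)) u = proj (gcdDiv (D y₁) (D y₂)) (a y₁ - γ * a y₂) then
          (1 / (q : ℝ)) * c y₁ * c y₂ else 0) else 0) =
        c y₁ * c y₂ * if lcmDiv (D y₁) (D y₂) = d then
          (1 / (gcdDiv (D y₁) (D y₂) : ℕ) : ℝ) else 0 := by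
      intro y₁ y₂
      by_cases hd : lcmDiv (D y₁) (D y₂) = d
      · simp only [hd, if_true]
        rw [← Finset.sum_filter, Finset.sum_const, nsmul_eq_mul, card_filter_proj]
        field_simp
      · simp [hd]
    simp_rw [h6]
    rw [sum_sum_mul_of_profile hs fun e f =>
      if lcmDiv e f = d then (1 / (gcdDiv e f : ℕ) : ℝ) else 0]
    simp only [epsStep, Finset.mul_sum]
    refine Finset.sum_congr rfl fun e _ => Finset.sum_congr rfl fun f _ => ?_
    simp only [Subtype.ext_iff, coe_lcmDiv]
    split_ifs with hd
    · have h5 := gcd_mul_lcm_cast e f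
      have h6 : ((gcdDiv e f : ℕ) : ℝ) ≠ 0 := by exact_mod_cast (divisors_pos _).ne'
      rw [coe_lcmDiv, hd] at h5
      field_simp
      linear_combination (-ε e * ε f) * h5
    · simp

theorem synthetic_profile {γ : ZMod q} (hγ : IsUnit γ) (s : List Sign) {W : Channel (ZMod q)}
    {ε : q.divisors → ℝ} (h : HasErasureProfile W ε) :
    HasErasureProfile (synthetic γ W s) (epsSeq ε s) := by
  induction s generalizing W ε with
  | nil => exact h
  | cons i s ih =>
    cases i
    · exact ih (worse_profile hγ h)
    · exact ih (better_profile hγ h)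

/-! ### Capacities -/

/-- Capacity of a channel each of whose outputs has a likelihood that is constant on a set of
inputs and zero off it: the output `y` contributes its probability `c y / k y` times the
information `log (k y)`, where `1 / k y` is the proportion of inputs in that set. -/
theorem symmetricCapacity_of_indicator (b : ℝ) {X : Type} [Fintype X] (W : Channel X)
    (S : W.Out → X → Prop) [∀ y, DecidablePred (S y)] (c k : W.Out → ℝ)
    (hW : ∀ x y, W.prob x y = if S y x then c y else 0)
    (hS : ∀ y, (1 / (Fintype.card X : ℝ)) * ((Finset.univ.filter (S y)).card : ℝ) = 1 / k y) :
    symmetricCapacity b W = ∑ y, c y / k y * Real.logb b (k y) := by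
  unfold symmetricCapacity
  refine Finset.sum_congr rfl fun y _ => ?_
  have h1 : ∀ t : ℝ, ∑ x, (1 / (Fintype.card X : ℝ)) * (if S y x then t else 0) = t / k y := by
    intro t
    rw [← Finset.mul_sum, ← Finset.sum_filter, Finset.sum_const, nsmul_eq_mul, ← mul_assoc, hS]
    ring
  simp_rw [hW, h1 (c y)]
  have h2 : ∀ x, (1 / (Fintype.card X : ℝ)) * (if S y x then c y else 0) *
      Real.logb b ((if S y x then c y else 0) / (c y / k y)) =
      (1 / (Fintype.card X : ℝ)) * (if S y x then c y * Real.logb b (k y) else 0) := by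
    intro x
    split_ifs
    · by_cases hc : c y = 0
      · simp [hc]
      · rw [div_div_cancel₀ hc]; ring
    · simp
  simp_rw [h2]
  rw [h1]; ring

theorem symmetricCapacity_of_profile {W : Channel (ZMod q)} {ε : q.divisors → ℝ}
    (h : HasErasureProfile W ε) (b : ℝ) :
    symmetricCapacity b W = ∑ d : q.divisors, ε d * Real.logb b (d : ℕ) := by
  obtain ⟨D, a, c, hp, hs⟩ := h
  have hq : (q : ℝ) ≠ 0 := Nat.cast_ne_zero.mpr (NeZero.ne q)
  have hd : ∀ d : q.divisors, ((d : ℕ) : ℝ) ≠ 0 := fun d => by exact_mod_cast (divisors_pos d).ne'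
  rw [symmetricCapacity_of_indicator b W (fun y x => proj (D y) x = proj (D y) (a y)) c
    (fun y => ((D y : ℕ) : ℝ)) hp fun y => by
      rw [card_filter_proj, ZMod.card]; field_simp]
  have := sum_mul_of_profile hs fun d => Real.logb b (d : ℕ) / (d : ℕ)
  simp only [← mul_div_assoc] at this
  simp only [div_mul_eq_mul_div]
  rw [this]
  refine Finset.sum_congr rfl fun d _ => ?_
  have := hd d
  field_simp

open Classical in
/-- On the quotient by `ker φ_d`, identified with `ℤ/dℤ`, an output revealing the residue modulo
`e` reveals the residue modulo `gcd(d, e)`. -/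
theorem homCapacity_of_profile {W : Channel (ZMod q)} {ε : q.divisors → ℝ}
    (h : HasErasureProfile W ε) (b : ℝ) (d : q.divisors) :
    homCapacity b W (proj d).ker = ∑ e : q.divisors, ε e * Real.logb b (Nat.gcd d e) := by
  obtain ⟨D, a, c, hp, hs⟩ := h
  have hq : (q : ℝ) ≠ 0 := Nat.cast_ne_zero.mpr (NeZero.ne q)
  have hd : ∀ d : q.divisors, ((d : ℕ) : ℝ) ≠ 0 := fun d => by exact_mod_cast (divisors_pos d).ne'
  have hN : (Nat.card (proj d).ker : ℝ) = q / (d : ℕ) := by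
    rw [← card_filter_proj d 0, Nat.card_eq_fintype_card, Fintype.card_subtype]
    simp only [AddMonoidHom.mem_ker]
  -- The instance hidden in `homCapacity` is irrelevant, so the formula is proved for all of them.
  suffices key : ∀ _ : Fintype (ZMod q ⧸ (proj d).ker),
      symmetricCapacity b (homChannel W (proj d).ker) =
        ∑ e : q.divisors, ε e * Real.logb b (Nat.gcd d e) from key _
  intro _
  have hX : (Fintype.card (ZMod q ⧸ (proj d).ker) : ℝ) = (d : ℕ) := by
    have h1 := Fintype.card_congr
      (QuotientAddGroup.quotientKerEquivOfSurjective (proj d) (proj_surjective d)).toEquiv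
    rw [ZMod.card] at h1
    exact_mod_cast h1
  have hmk : ∀ x y : ZMod q, ((x : ZMod q ⧸ (proj d).ker) = y) ↔ proj d x = proj d y := by
    intro x y
    rw [QuotientAddGroup.eq, AddMonoidHom.mem_ker, map_add, map_neg, neg_add_eq_zero]
  rw [symmetricCapacity_of_indicator b (homChannel W (proj d).ker)
    (fun y z => ∃ x : ZMod q, (x : ZMod q ⧸ (proj d).ker) = z ∧
      proj (gcdDiv d (D y)) x = proj (gcdDiv d (D y)) (a y))
    (fun y => c y * ((gcdDiv d (D y) : ℕ) / (D y : ℕ)))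
    (fun y => ((gcdDiv d (D y) : ℕ) : ℝ)) ?_ ?_]
  · change (∑ y : W.Out, _) = _
    have := sum_mul_of_profile hs fun e => Real.logb b (Nat.gcd d e) / (e : ℕ)
    have h1 : ∀ y, c y * ((gcdDiv d (D y) : ℕ) / (D y : ℕ)) / (gcdDiv d (D y) : ℕ) *
        Real.logb b (gcdDiv d (D y) : ℕ) = c y * (Real.logb b (Nat.gcd d (D y)) / (D y : ℕ)) := by
      intro y
      have := hd (gcdDiv d (D y))
      rw [← coe_gcdDiv]
      field_simp
    simp_rw [h1, this]
    refine Finset.sum_congr rfl fun e _ => ?_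
    have := hd e
    field_simp
  · intro z (y : W.Out)
    obtain ⟨z, rfl⟩ := QuotientAddGroup.mk_surjective z
    have h0 : (homChannel W (proj d).ker).prob z y = (1 / (Nat.card (proj d).ker : ℝ)) *
        ∑ x ∈ Finset.univ.filter (fun x : ZMod q => (x : ZMod q ⧸ (proj d).ker) = z),
          W.prob x y := by
      simp only [homChannel]
      congr!
    have h1 : (∃ x : ZMod q, (x : ZMod q ⧸ (proj d).ker) = z ∧
        proj (gcdDiv d (D y)) x = proj (gcdDiv d (D y)) (a y)) ↔
        proj (gcdDiv d (D y)) z = proj (gcdDiv d (D y)) (a y) := by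
      constructor
      · rintro ⟨x, h2, h3⟩
        rw [← h3]
        exact (proj_eq_of_dvd (Nat.gcd_dvd_left _ _) ((hmk _ _).1 h2)).symm
      · exact fun h => ⟨z, rfl, h⟩
    refine h0.trans ?_
    rw [if_congr h1 rfl rfl]
    simp_rw [hp, hmk]
    rw [← Finset.sum_filter, Finset.filter_filter, Finset.sum_const, nsmul_eq_mul,
      card_filter_proj_and, hN]
    split_ifs
    · have h2 := gcd_mul_lcm_cast d (D y)
      have := hd d
      have := hd (D y)
      have := hd (lcmDiv d (D y))
      field_simp
      linear_combination (-c y) * h2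
    · simp
  · intro y
    -- Count the classes through their preimages in `ℤ/qℤ`, each of which has `q / d` elements.
    have h1 : ((Finset.univ.filter fun x : ZMod q =>
        proj (gcdDiv d (D y)) x = proj (gcdDiv d (D y)) (a y)).card : ℝ) =
        ((Finset.univ.filter fun z : ZMod q ⧸ (proj d).ker => ∃ x : ZMod q,
          (x : ZMod q ⧸ (proj d).ker) = z ∧
          proj (gcdDiv d (D y)) x = proj (gcdDiv d (D y)) (a y)).card : ℝ) * (q / (d : ℕ)) := by
      rw [Finset.card_eq_sum_card_fiberwise (f := fun x : ZMod q => (x : ZMod q ⧸ (proj d).ker))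
        (t := Finset.univ.filter fun z : ZMod q ⧸ (proj d).ker => ∃ x : ZMod q,
          (x : ZMod q ⧸ (proj d).ker) = z ∧
          proj (gcdDiv d (D y)) x = proj (gcdDiv d (D y)) (a y))]
      · rw [Nat.cast_sum, ← nsmul_eq_mul]
        refine Finset.sum_eq_card_nsmul fun z hz => ?_
        obtain ⟨x, rfl, hx⟩ := (Finset.mem_filter.1 hz).2
        rw [← card_filter_proj d (proj d x), Finset.filter_filter]
        congr 2
        ext x'
        simp only [Finset.mem_filter, Finset.mem_univ, true_and, hmk]
        refine ⟨fun h => h.2, fun h => ⟨?_, h⟩⟩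
        rw [← hx]
        exact proj_eq_of_dvd (Nat.gcd_dvd_left _ _) h
      · intro x hx
        simp only [Finset.coe_filter, Finset.mem_univ, true_and, Set.mem_ofPred_eq] at hx ⊢
        exact ⟨x, rfl, hx⟩
    rw [card_filter_proj] at h1
    rw [hX]
    have := hd d
    have := hd (gcdDiv d (D y))
    field_simp at h1 ⊢
    linear_combination -h1

end

/-! ### Averages over sign sequences -/

/-- The average of `f (ε^s)` over all sign sequences `s` of length `n`. -/
noncomputable def signAvg (ε : q.divisors → ℝ) (n : ℕ) (f : (q.divisors → ℝ) → ℝ) : ℝ :=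
  (1 / (2 : ℝ) ^ n) * ∑ s : Fin n → Sign, f (epsSeq ε (List.ofFn s))

theorem sum_sign (f : Sign → ℝ) : ∑ i, f i = f Sign.minus + f Sign.plus := by
  rw [← signEquivBool.symm.sum_comp, Fintype.sum_bool, add_comm]
  rfl

theorem card_sign : Fintype.card Sign = 2 := by
  rw [Fintype.card_congr signEquivBool, Fintype.card_bool]

theorem signAvg_succ (ε : q.divisors → ℝ) (n : ℕ) (f : (q.divisors → ℝ) → ℝ) :
    signAvg ε (n + 1) f = signAvg ε n fun e =>
      (f (epsStep e Sign.minus) + f (epsStep e Sign.plus)) / 2 := by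
  unfold signAvg
  rw [← (Fin.snocEquiv fun _ : Fin (n + 1) => Sign).sum_comp, Fintype.sum_prod_type_right]
  simp_rw [sum_sign, ← Finset.sum_div, pow_succ]
  have h : ∀ (s : Fin n → Sign) (i : Sign),
      epsSeq ε (List.ofFn ((Fin.snocEquiv fun _ : Fin (n + 1) => Sign) (i, s))) =
        epsStep (epsSeq ε (List.ofFn s)) i := by
    intro s i
    rw [List.ofFn_succ']
    simp [epsSeq, Fin.snocEquiv, List.concat_eq_append]
  simp_rw [h]
  field_simp

theorem signAvg_const (ε : q.divisors → ℝ) (n : ℕ) (r : ℝ) : signAvg ε n (fun _ => r) = r := by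
  simp [signAvg, card_sign]

theorem signAvg_add (ε : q.divisors → ℝ) (n : ℕ) (f g : (q.divisors → ℝ) → ℝ) :
    signAvg ε n (fun e => f e + g e) = signAvg ε n f + signAvg ε n g := by
  simp [signAvg, Finset.sum_add_distrib, mul_add]

theorem signAvg_sub (ε : q.divisors → ℝ) (n : ℕ) (f g : (q.divisors → ℝ) → ℝ) :
    signAvg ε n (fun e => f e - g e) = signAvg ε n f - signAvg ε n g := by
  simp [signAvg, Finset.sum_sub_distrib, mul_sub]

theorem signAvg_const_mul (ε : q.divisors → ℝ) (n : ℕ) (r : ℝ) (f : (q.divisors → ℝ) → ℝ) :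
    signAvg ε n (fun e => r * f e) = r * signAvg ε n f := by
  simp only [signAvg, ← Finset.mul_sum]; ring

theorem signAvg_sum {ι : Type*} (S : Finset ι) (ε : q.divisors → ℝ) (n : ℕ)
    (f : ι → (q.divisors → ℝ) → ℝ) :
    signAvg ε n (fun e => ∑ i ∈ S, f i e) = ∑ i ∈ S, signAvg ε n (f i) := by
  simp only [signAvg, ← Finset.mul_sum]
  rw [Finset.sum_comm]

theorem mu_eq_signAvg (ε : q.divisors → ℝ) (n : ℕ) (d : q.divisors) :
    mu ε n d = signAvg ε n fun e => e d := rfl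

/-- The total mass that `ε` gives to the multiples of `t`. -/
noncomputable def upperMass (t : q.divisors) (ε : q.divisors → ℝ) : ℝ :=
  ∑ d : q.divisors, (if (t : ℕ) ∣ d then 1 else 0) * ε d

theorem upperMass_nonneg {ε : q.divisors → ℝ} (hε : ε ∈ stdSimplex ℝ q.divisors)
    (t : q.divisors) : 0 ≤ upperMass t ε :=
  Finset.sum_nonneg fun d _ => mul_nonneg (by split_ifs <;> norm_num) (hε.1 d)

theorem upperMass_le_one {ε : q.divisors → ℝ} (hε : ε ∈ stdSimplex ℝ q.divisors)
    (t : q.divisors) : upperMass t ε ≤ 1 := by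
  rw [← hε.2]
  refine Finset.sum_le_sum fun d _ => mul_le_of_le_one_left (hε.1 d) ?_
  split_ifs <;> norm_num

theorem le_upperMass {ε : q.divisors → ℝ} (hε : ε ∈ stdSimplex ℝ q.divisors)
    (t : q.divisors) : ε t ≤ upperMass t ε := by
  have := Finset.single_le_sum
    (f := fun d : q.divisors => (if (t : ℕ) ∣ d then (1 : ℝ) else 0) * ε d)
    (fun d _ => mul_nonneg (by split_ifs <;> norm_num) (hε.1 d)) (Finset.mem_univ t)
  rwa [if_pos (dvd_refl _), one_mul] at this

/-- A weighted average of values in `[0, 1]` is close to the value carrying most of the weight. -/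
theorem abs_sum_mul_sub_le {ε : q.divisors → ℝ} (hε : ε ∈ stdSimplex ℝ q.divisors)
    {g : q.divisors → ℝ} (hg : ∀ d, 0 ≤ g d ∧ g d ≤ 1) (d : q.divisors) :
    |∑ e, ε e * g e - g d| ≤ 1 - ε d := by
  have h1 : ∑ e, ε e * g e - g d = ∑ e, ε e * (g e - g d) := by
    simp only [mul_sub, Finset.sum_sub_distrib, ← Finset.sum_mul, hε.2, one_mul]
  have h2 : 1 - ε d = ∑ e, if e = d then 0 else ε e := by
    have h3 : ∑ e, (if e = d then ε e else 0) = ε d := by simp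
    rw [← hε.2, sub_eq_iff_eq_add, ← h3, ← Finset.sum_add_distrib]
    refine Finset.sum_congr rfl fun e _ => ?_
    split_ifs <;> simp
  rw [h1, h2]
  refine (Finset.abs_sum_le_sum_abs _ _).trans (Finset.sum_le_sum fun e _ => ?_)
  split_ifs with he
  · simp [he]
  · rw [abs_mul, abs_of_nonneg (hε.1 e)]
    refine mul_le_of_le_one_right (hε.1 e) (abs_le.2 ⟨?_, ?_⟩) <;>
      linarith [(hg e).1, (hg e).2, (hg d).1, (hg d).2]

variable [NeZero q]

/-! ### Polarization of the mass vectors -/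

theorem sum_mul_epsStep_minus (ε g : q.divisors → ℝ) :
    ∑ d, g d * epsStep ε Sign.minus d =
      ∑ d, ∑ e, g (gcdDiv d e) * (ε d * ε e) := by
  simp only [epsStep, Finset.mul_sum]
  rw [Finset.sum_comm]
  refine Finset.sum_congr rfl fun d _ => ?_
  rw [Finset.sum_comm]
  refine Finset.sum_congr rfl fun e _ => ?_
  rw [Finset.sum_eq_single (gcdDiv d e)]
  · rw [if_pos (by rfl)]
  · exact fun f _ hf => by rw [if_neg fun h => hf (Subtype.ext h.symm), mul_zero]
  · simp

theorem sum_mul_epsStep_plus (ε g : q.divisors → ℝ) :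
    ∑ d, g d * epsStep ε Sign.plus d =
      ∑ d, ∑ e, g (lcmDiv d e) * (ε d * ε e) := by
  simp only [epsStep, Finset.mul_sum]
  rw [Finset.sum_comm]
  refine Finset.sum_congr rfl fun d _ => ?_
  rw [Finset.sum_comm]
  refine Finset.sum_congr rfl fun e _ => ?_
  rw [Finset.sum_eq_single (lcmDiv d e)]
  · rw [if_pos (by rfl)]
  · exact fun f _ hf => by rw [if_neg fun h => hf (Subtype.ext h.symm), mul_zero]
  · simp

theorem epsStep_mem {ε : q.divisors → ℝ} (hε : ε ∈ stdSimplex ℝ q.divisors) (i : Sign) :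
    epsStep ε i ∈ stdSimplex ℝ q.divisors := by
  have h1 : ∑ d, ∑ e, ε d * ε e = 1 := by rw [← Fintype.sum_mul_sum, hε.2, one_mul]
  refine ⟨fun d => ?_, ?_⟩
  · cases i <;>
    · refine Finset.sum_nonneg fun e _ => Finset.sum_nonneg fun f _ => ?_
      split_ifs
      exacts [mul_nonneg (hε.1 _) (hε.1 _), le_rfl]
  · cases i
    · simpa only [one_mul, h1] using sum_mul_epsStep_minus ε fun _ => 1
    · simpa only [one_mul, h1] using sum_mul_epsStep_plus ε fun _ => 1

theorem epsSeq_mem (s : List Sign) {ε : q.divisors → ℝ} (hε : ε ∈ stdSimplex ℝ q.divisors) :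
    epsSeq ε s ∈ stdSimplex ℝ q.divisors := by
  induction s generalizing ε with
  | nil => exact hε
  | cons i s ih => exact ih (epsStep_mem hε i)

theorem signAvg_mono {ε : q.divisors → ℝ} (hε : ε ∈ stdSimplex ℝ q.divisors) (n : ℕ)
    {f g : (q.divisors → ℝ) → ℝ} (h : ∀ e ∈ stdSimplex ℝ q.divisors, f e ≤ g e) :
    signAvg ε n f ≤ signAvg ε n g :=
  mul_le_mul_of_nonneg_left (Finset.sum_le_sum fun _ _ => h _ (epsSeq_mem _ hε)) (by positivity)

theorem abs_signAvg_le {ε : q.divisors → ℝ} (hε : ε ∈ stdSimplex ℝ q.divisors) (n : ℕ)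
    {f g : (q.divisors → ℝ) → ℝ} (h : ∀ e ∈ stdSimplex ℝ q.divisors, |f e| ≤ g e) :
    |signAvg ε n f| ≤ signAvg ε n g := by
  refine abs_le.2 ⟨?_, signAvg_mono hε n fun e he => (abs_le.1 (h e he)).2⟩
  rw [neg_le, ← neg_one_mul, ← signAvg_const_mul]
  exact signAvg_mono hε n fun e he => by linarith [(abs_le.1 (h e he)).1]

theorem upperMass_minus (t : q.divisors) (ε : q.divisors → ℝ) :
    upperMass t (epsStep ε Sign.minus) = upperMass t ε ^ 2 := by
  rw [upperMass, sum_mul_epsStep_minus ε fun d => if (t : ℕ) ∣ d then 1 else 0, pow_two, upperMass,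
    Fintype.sum_mul_sum]
  refine Finset.sum_congr rfl fun d _ => Finset.sum_congr rfl fun e _ => ?_
  by_cases h1 : (t : ℕ) ∣ d <;> by_cases h2 : (t : ℕ) ∣ e <;>
    simp [coe_gcdDiv, Nat.dvd_gcd_iff, h1, h2]

/-- A common multiple of two divisors is a multiple of `t` as soon as one of them is. Equality
fails in general, since `t ∣ lcm(d, e)` does not imply `t ∣ d` or `t ∣ e`. -/
theorem upperMass_plus_ge {ε : q.divisors → ℝ} (hε : ε ∈ stdSimplex ℝ q.divisors)
    (t : q.divisors) :
    2 * upperMass t ε - upperMass t ε ^ 2 ≤ upperMass t (epsStep ε Sign.plus) := by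
  have h1 : 2 * upperMass t ε - upperMass t ε ^ 2 = ∑ d : q.divisors, ∑ e : q.divisors,
      ((if (t : ℕ) ∣ d then 1 else 0) + (if (t : ℕ) ∣ e then 1 else 0)
        - (if (t : ℕ) ∣ d then 1 else 0) * (if (t : ℕ) ∣ e then 1 else 0)) * (ε d * ε e) := by
    have h2 : 2 * upperMass t ε - upperMass t ε ^ 2 = upperMass t ε * (∑ e, ε e) +
        (∑ d, ε d) * upperMass t ε - upperMass t ε * upperMass t ε := by rw [hε.2]; ring
    rw [h2, upperMass, Fintype.sum_mul_sum, Fintype.sum_mul_sum, Fintype.sum_mul_sum]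
    simp only [← Finset.sum_add_distrib, ← Finset.sum_sub_distrib]
    exact Finset.sum_congr rfl fun d _ => Finset.sum_congr rfl fun e _ => by ring
  rw [h1, upperMass, sum_mul_epsStep_plus ε fun d => if (t : ℕ) ∣ d then 1 else 0]
  refine Finset.sum_le_sum fun d _ => Finset.sum_le_sum fun e _ =>
    mul_le_mul_of_nonneg_right ?_ (mul_nonneg (hε.1 d) (hε.1 e))
  have k1 : (t : ℕ) ∣ d → (t : ℕ) ∣ lcmDiv d e := fun h => h.trans (Nat.dvd_lcm_left _ _)
  have k2 : (t : ℕ) ∣ e → (t : ℕ) ∣ lcmDiv d e := fun h => h.trans (Nat.dvd_lcm_right _ _)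
  by_cases h1 : (t : ℕ) ∣ d <;> by_cases h2 : (t : ℕ) ∣ e <;>
    by_cases h3 : (t : ℕ) ∣ lcmDiv d e <;> simp [h1, h2, h3] <;> tauto

theorem exists_tendsto_signAvg_upperMass {ε : q.divisors → ℝ}
    (hε : ε ∈ stdSimplex ℝ q.divisors) (t : q.divisors) :
    ∃ l, Tendsto (fun n => signAvg ε n (upperMass t)) atTop (𝓝 l) := by
  refine ⟨_, tendsto_atTop_ciSup (monotone_nat_of_le_succ fun n => ?_) ⟨1, ?_⟩⟩
  · rw [signAvg_succ]
    refine signAvg_mono hε n fun e he => ?_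
    rw [upperMass_minus]
    linarith [upperMass_plus_ge he t]
  · rintro _ ⟨n, rfl⟩
    rw [← signAvg_const ε n 1]
    exact signAvg_mono hε n fun e he => upperMass_le_one he t

/-- The averages of the squared upper masses grow at the `n`-th step by at least the average of
`(g (1 - g))²`, where `g` is the upper mass; as they stay below `1`, the growth tends to `0`. -/
theorem tendsto_signAvg_sq {ε : q.divisors → ℝ} (hε : ε ∈ stdSimplex ℝ q.divisors)
    (t : q.divisors) : Tendsto (fun n => signAvg ε n fun e =>
      (upperMass t e * (1 - upperMass t e)) ^ 2) atTop (𝓝 0) := by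
  have hstep : ∀ n, signAvg ε n (fun e => (upperMass t e * (1 - upperMass t e)) ^ 2) ≤
      signAvg ε (n + 1) (fun e => upperMass t e ^ 2) -
        signAvg ε n (fun e => upperMass t e ^ 2) := by
    intro n
    rw [signAvg_succ, ← signAvg_sub]
    refine signAvg_mono hε n fun e he => ?_
    have h0 := upperMass_nonneg he t
    have h1 := upperMass_le_one he t
    have h2 := upperMass_plus_ge he t
    rw [upperMass_minus]
    have h3 : (2 * upperMass t e - upperMass t e ^ 2) ^ 2 ≤
        upperMass t (epsStep e Sign.plus) ^ 2 := pow_le_pow_left₀ (by nlinarith) h2 2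
    -- `(g⁴ + (2g - g²)²) / 2 - g² = (g (1 - g))²`.
    nlinarith
  have hnn : ∀ n, 0 ≤ signAvg ε n fun e => (upperMass t e * (1 - upperMass t e)) ^ 2 := fun n => by
    rw [← signAvg_const ε n 0]
    exact signAvg_mono hε n fun e _ => sq_nonneg _
  have hlim : Tendsto (fun n => signAvg ε n fun e => upperMass t e ^ 2) atTop
      (𝓝 (⨆ n, signAvg ε n fun e => upperMass t e ^ 2)) := by
    refine tendsto_atTop_ciSup (monotone_nat_of_le_succ fun n => ?_) ⟨1, ?_⟩
    · linarith [hstep n, hnn n]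
    · rintro _ ⟨n, rfl⟩
      rw [← signAvg_const ε n 1]
      exact signAvg_mono hε n fun e he =>
        pow_le_one₀ (upperMass_nonneg he t) (upperMass_le_one he t)
  have hdiff := (hlim.comp (tendsto_add_atTop_nat 1)).sub hlim
  rw [sub_self] at hdiff
  exact squeeze_zero hnn hstep hdiff

/-- The masses are recovered from the upper masses by descending induction on the divisor. -/
theorem exists_tendsto_mu {ε : q.divisors → ℝ} (hε : ε ∈ stdSimplex ℝ q.divisors)
    (d : q.divisors) : ∃ l, Tendsto (fun n => mu ε n d) atTop (𝓝 l) := by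
  induction hk : q - (d : ℕ) using Nat.strong_induction_on generalizing d with
  | _ k ih =>
    have hd : ∀ e : q.divisors, (e : ℕ) ≤ q := fun e =>
      Nat.le_of_dvd (NeZero.pos q) (Nat.dvd_of_mem_divisors e.2)
    have h1 : ∀ e : q.divisors, ∃ l, Tendsto
        (fun n => (if (d : ℕ) ∣ e ∧ e ≠ d then 1 else 0) * mu ε n e) atTop (𝓝 l) := by
      intro e
      split_ifs with he
      · have hlt : (d : ℕ) < e := lt_of_le_of_ne
          (Nat.le_of_dvd (divisors_pos e) he.1) fun h => he.2 (Subtype.ext h.symm)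
        have := hd e
        obtain ⟨l, hl⟩ := ih (q - e) (by omega) e rfl
        exact ⟨l, by simpa using hl⟩
      · exact ⟨0, by simp⟩
    choose l hl using h1
    obtain ⟨L, hL⟩ := exists_tendsto_signAvg_upperMass hε d
    refine ⟨L - ∑ e, l e, (hL.sub (tendsto_finsetSum Finset.univ fun e _ => hl e)).congr
      fun n => ?_⟩
    simp_rw [mu_eq_signAvg, ← signAvg_const_mul]
    rw [← signAvg_sum, ← signAvg_sub]
    congr 1
    funext e
    rw [upperMass, ← Finset.sum_sub_distrib, Finset.sum_eq_single d]
    · simp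
    · intro f _ hf
      by_cases h : (d : ℕ) ∣ f <;> simp [h, hf]
    · simp

/-- If every upper mass is within `η` of `0` or `1`, then almost all of the mass sits on one
divisor: a maximal one among those whose upper mass is near `1`. -/
theorem exists_concentrated {ε : q.divisors → ℝ} (hε : ε ∈ stdSimplex ℝ q.divisors) {η : ℝ}
    (hη : 0 < η) (h : ∀ t, upperMass t ε < η ∨ 1 - η < upperMass t ε) :
    ∃ d, 1 - ε d ≤ (1 + Fintype.card q.divisors) * η := by
  classical
  have hne : (Finset.univ.filter fun t : q.divisors => 1 - η < upperMass t ε).Nonempty := by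
    refine ⟨⟨1, by simp [NeZero.ne q]⟩, Finset.mem_filter.2 ⟨Finset.mem_univ _, ?_⟩⟩
    simp only [upperMass, one_dvd, if_true, one_mul, hε.2]
    linarith
  obtain ⟨d, hd, hmax⟩ := Finset.exists_max_image _ (fun t : q.divisors => (t : ℕ)) hne
  refine ⟨d, ?_⟩
  have h1 : upperMass d ε ≤ ε d + ∑ _e : q.divisors, η := by
    have : ε d = ∑ e, if e = d then ε e else 0 := by simp
    rw [this, upperMass, ← Finset.sum_add_distrib]
    refine Finset.sum_le_sum fun e _ => ?_
    by_cases he : e = d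
    · simp [he, hη.le]
    · by_cases hde : (d : ℕ) ∣ e
      · have hlt : (d : ℕ) < e := lt_of_le_of_ne
          (Nat.le_of_dvd (divisors_pos e) hde) fun h => he (Subtype.ext h.symm)
        have h2 : upperMass e ε < η := (h e).resolve_right fun h3 =>
          absurd (hmax e (Finset.mem_filter.2 ⟨Finset.mem_univ _, h3⟩)) (not_le.2 hlt)
        simp [hde, he, (le_upperMass hε e).trans h2.le]
      · simp [hde, he, hη.le]
  have h2 := (Finset.mem_filter.1 hd).2
  simp only [Finset.sum_const, Finset.card_univ, nsmul_eq_mul] at h1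
  linarith

/-! ### From point masses to capacities -/

/-- Divisors of `q` whose base-`q` logarithms differ by less than that of the smallest prime
factor of `q` are equal, if one divides the other. -/
theorem eq_of_dvd_of_logb_lt (hq : 2 ≤ q) {a b : ℕ} (hab : a ∣ b) (hb : b ∣ q)
    (h : Real.logb q b - Real.logb q a < Real.logb q q.minFac) : a = b := by
  obtain ⟨k, rfl⟩ := hab
  have hpos : 0 < a * k := Nat.pos_of_dvd_of_pos hb (NeZero.pos q)
  have ha : 0 < a := Nat.pos_of_mul_pos_right hpos
  have hk : 0 < k := Nat.pos_of_mul_pos_left hpos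
  have hq1 : (1 : ℝ) < q := by exact_mod_cast hq
  rw [Nat.cast_mul, Real.logb_mul (by positivity) (by positivity), add_sub_cancel_left] at h
  have hlt : k < q.minFac := by
    by_contra hle
    rw [not_lt] at hle
    have hm := Nat.minFac_pos q
    exact absurd (Real.logb_le_logb_of_le hq1 (by exact_mod_cast hm)
      (by exact_mod_cast hle : (q.minFac : ℝ) ≤ k)) (not_le.2 h)
  have : k = 1 := by
    by_contra h1
    exact absurd (Nat.minFac_le_of_dvd (by omega) ((Dvd.intro_left a rfl).trans hb)) (not_le.2 hlt)
  rw [this, mul_one]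

theorem logb_mem_unit (hq : 2 ≤ q) {k : ℕ} (hk : k ∣ q) :
    0 ≤ Real.logb q k ∧ Real.logb q k ≤ 1 := by
  have hq1 : (1 : ℝ) < q := by exact_mod_cast hq
  have hk0 : 0 < k := Nat.pos_of_dvd_of_pos hk (NeZero.pos q)
  refine ⟨Real.logb_nonneg hq1 (by exact_mod_cast hk0), ?_⟩
  rw [← Real.logb_self_eq_one hq1]
  exact Real.logb_le_logb_of_le hq1 (by exact_mod_cast hk0)
    (by exact_mod_cast Nat.le_of_dvd (NeZero.pos q) hk)

/-- The event that a channel with erasure profile `ε` satisfies both capacity estimates at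
level `d`. -/
def NearLevel (δ : ℝ) (d : q.divisors) (ε : q.divisors → ℝ) : Prop :=
  |∑ e : q.divisors, ε e * Real.logb q (e : ℕ) - Real.logb q (d : ℕ)| < δ ∧
    |∑ e : q.divisors, ε e * Real.logb q (Nat.gcd d e) - Real.logb q (d : ℕ)| < δ

theorem nearLevel_iff (hq : 2 ≤ q) {δ κ : ℝ} (hκδ : κ < δ)
    (hκ : δ + κ ≤ Real.logb q q.minFac) {ε : q.divisors → ℝ}
    (hε : ε ∈ stdSimplex ℝ q.divisors) {d₀ : q.divisors} (h₀ : 1 - ε d₀ ≤ κ) (d : q.divisors) :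
    NearLevel δ d ε ↔ d = d₀ := by
  have hdvd : ∀ e : q.divisors, (e : ℕ) ∣ q := fun e => Nat.dvd_of_mem_divisors e.2
  have h1 := (abs_sum_mul_sub_le hε (fun e => logb_mem_unit hq (hdvd e)) d₀).trans h₀
  have h2 := (abs_sum_mul_sub_le hε (g := fun e => Real.logb q (Nat.gcd d e))
    (fun e => logb_mem_unit hq ((Nat.gcd_dvd_left _ _).trans (hdvd d))) d₀).trans h₀
  constructor
  · rintro ⟨h3, h4⟩
    rw [abs_le] at h1 h2
    rw [abs_lt] at h3 h4
    have h5 : Nat.gcd d d₀ = d := eq_of_dvd_of_logb_lt hq (Nat.gcd_dvd_left _ _) (hdvd d)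
      (by linarith)
    exact Subtype.ext (eq_of_dvd_of_logb_lt hq (Nat.gcd_eq_left_iff_dvd.1 h5) (hdvd d₀)
      (by linarith))
  · rintro rfl
    simp only [Nat.gcd_self] at h2
    exact ⟨h1.trans_lt hκδ, h2.trans_lt hκδ⟩

open Classical in
/-- The indicator of `NearLevel δ d` differs from the mass at `d` by little, up to an error
measuring how far the upper masses are from `0` and `1`. -/
theorem abs_indicator_sub_le (hq : 2 ≤ q) {δ κ : ℝ} (hκ0 : 0 < κ) (hκδ : κ < δ)
    (hκ : δ + κ ≤ Real.logb q q.minFac) (d : q.divisors) :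
    ∃ C : ℝ, ∀ ε ∈ stdSimplex ℝ q.divisors, |(if NearLevel δ d ε then 1 else 0) - ε d| ≤
      κ + C * ∑ t, (upperMass t ε * (1 - upperMass t ε)) ^ 2 := by
  -- For this `η`, `exists_concentrated` yields mass at least `1 - κ` on one divisor.
  set η : ℝ := κ / (1 + Fintype.card q.divisors) with hη
  have hη0 : 0 < η := by positivity
  refine ⟨1 / η ^ 4, fun ε hε => ?_⟩
  have hone : ∀ e, ε e ≤ 1 := fun e => (le_upperMass hε e).trans (upperMass_le_one hε e)
  have hsum : 0 ≤ ∑ t, (upperMass t ε * (1 - upperMass t ε)) ^ 2 :=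
    Finset.sum_nonneg fun t _ => sq_nonneg _
  -- If some upper mass is at least `η` away from `0` and `1`, the error term is at least `1`.
  by_cases hgood : ∀ t, upperMass t ε < η ∨ 1 - η < upperMass t ε
  · obtain ⟨d₀, hd₀⟩ := exists_concentrated hε hη0 hgood
    have hle : 1 - ε d₀ ≤ κ := hd₀.trans_eq (by rw [hη]; field_simp)
    refine le_trans ?_ (le_add_of_nonneg_right (by positivity))
    simp only [nearLevel_iff hq hκδ hκ hε hle]
    split_ifs with h
    · rwa [h, abs_of_nonneg (by linarith [hone d₀])]
    · have h1 : ε d + ε d₀ ≤ 1 := by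
        rw [← hε.2, ← Finset.sum_pair h]
        exact Finset.sum_le_sum_of_subset_of_nonneg (Finset.subset_univ _) fun e _ _ => hε.1 e
      rw [zero_sub, abs_neg, abs_of_nonneg (hε.1 d)]
      linarith
  · push Not at hgood
    obtain ⟨t, h1, h2⟩ := hgood
    have h3 : η ^ 4 ≤ (upperMass t ε * (1 - upperMass t ε)) ^ 2 := by
      have : η * η ≤ upperMass t ε * (1 - upperMass t ε) :=
        mul_le_mul h1 (by linarith) hη0.le (hη0.le.trans h1)
      calc η ^ 4 = (η * η) ^ 2 := by ring
        _ ≤ _ := pow_le_pow_left₀ (by positivity) this 2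
    have h4 : η ^ 4 ≤ ∑ t, (upperMass t ε * (1 - upperMass t ε)) ^ 2 :=
      h3.trans (Finset.single_le_sum (f := fun t => (upperMass t ε * (1 - upperMass t ε)) ^ 2)
        (fun t _ => sq_nonneg _) (Finset.mem_univ t))
    have h5 : 1 ≤ 1 / η ^ 4 * ∑ t, (upperMass t ε * (1 - upperMass t ε)) ^ 2 := by
      rw [one_div_mul_eq_div, one_le_div (by positivity)]
      exact h4
    have h6 : |(if NearLevel δ d ε then 1 else 0) - ε d| ≤ 1 := by
      have := hε.1 d
      have := hone d
      split_ifs <;> rw [abs_le] <;> constructor <;> linarith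
    linarith

open Classical in
theorem levelFraction_eq_signAvg {γ : ZMod q} (hγ : IsUnit γ) (ε : q.divisors → ℝ)
    (hε : ε ∈ stdSimplex ℝ q.divisors) (δ : ℝ) (d : q.divisors) (n : ℕ) :
    levelFraction γ ε hε δ d n = signAvg ε n fun e => if NearLevel δ d e then 1 else 0 := by
  unfold levelFraction signAvg
  congr 1
  rw [Finset.sum_boole, ← Set.ncard_coe_finset]
  congr 2
  ext s
  have hprof := synthetic_profile hγ (List.ofFn s) (maec_profile ε hε)
  rw [Finset.mem_coe, Finset.mem_filter]
  simp only [Set.mem_ofPred_eq, Finset.mem_univ, true_and, NearLevel,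
    symmetricCapacity_of_profile hprof, homCapacity_of_profile hprof]

open Classical in
theorem tendsto_signAvg_indicator_sub (hq : 2 ≤ q) {ε : q.divisors → ℝ}
    (hε : ε ∈ stdSimplex ℝ q.divisors) {δ : ℝ} (hδ0 : 0 < δ) (hδ : δ < Real.logb q q.minFac)
    (d : q.divisors) : Tendsto (fun n => signAvg ε n
      fun e => (if NearLevel δ d e then 1 else 0) - e d) atTop (𝓝 0) := by
  rw [Metric.tendsto_atTop]
  intro r hr
  obtain ⟨κ, hκ0, hκ⟩ : ∃ κ, 0 < κ ∧ κ < min (r / 2) (min δ (Real.logb q q.minFac - δ)) :=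
    exists_between (lt_min (by linarith) (lt_min hδ0 (by linarith)))
  rw [lt_min_iff, lt_min_iff] at hκ
  obtain ⟨C, hC⟩ := abs_indicator_sub_le hq hκ0 hκ.2.1 (by linarith [hκ.2.2]) d
  have hlim : Tendsto (fun n => C * ∑ t, signAvg ε n fun e =>
      (upperMass t e * (1 - upperMass t e)) ^ 2) atTop (𝓝 0) := by
    simpa using (tendsto_finsetSum Finset.univ fun t _ => tendsto_signAvg_sq hε t).const_mul C
  obtain ⟨N, hN⟩ := eventually_atTop.1 (hlim.eventually (gt_mem_nhds (half_pos hr)))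
  refine ⟨N, fun n hn => ?_⟩
  rw [Real.dist_eq, sub_zero]
  have h1 := abs_signAvg_le hε n hC
  rw [signAvg_add, signAvg_const, signAvg_const_mul, signAvg_sum] at h1
  linarith [hN n hn]

end MAEC

theorem mainTheorem9 (q : ℕ) [NeZero q] (hq : 2 ≤ q) (γ : ZMod q) (hγ : IsUnit γ)
    (ε : q.divisors → ℝ) (hε : ε ∈ stdSimplex ℝ q.divisors) :
    ∃ μ : q.divisors → ℝ, μ ∈ stdSimplex ℝ q.divisors ∧
      (∀ d : q.divisors, Tendsto (fun n => MAEC.mu ε n d) atTop (𝓝 (μ d))) ∧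
      ∀ δ : ℝ, 0 < δ → δ < Real.logb q q.minFac → ∀ d : q.divisors,
        Tendsto (fun n => MAEC.levelFraction γ ε hε δ d n) atTop (𝓝 (μ d)) := by
  choose μ hμ using MAEC.exists_tendsto_mu hε
  have hmem : ∀ n, (fun d => MAEC.mu ε n d) ∈ stdSimplex ℝ q.divisors := by
    refine fun n => ⟨fun d => ?_, ?_⟩
    · exact mul_nonneg (by positivity) (Finset.sum_nonneg fun s _ => (MAEC.epsSeq_mem _ hε).1 d)
    · simp only [MAEC.mu, ← Finset.mul_sum]
      rw [Finset.sum_comm, Finset.sum_congr rfl fun s _ => (MAEC.epsSeq_mem _ hε).2]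
      simp [MAEC.card_sign]
  refine ⟨μ, ?_, hμ, fun δ hδ0 hδ d => ?_⟩
  · exact (isClosed_stdSimplex ℝ q.divisors).mem_of_tendsto (tendsto_pi_nhds.2 hμ)
      (Eventually.of_forall hmem)
  · have h := (MAEC.tendsto_signAvg_indicator_sub hq hε hδ0 hδ d).add (hμ d)
    rw [zero_add] at h
    refine h.congr fun n => ?_
    rw [MAEC.levelFraction_eq_signAvg hγ, MAEC.signAvg_sub, MAEC.mu_eq_signAvg, sub_add_cancel]
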